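/- **Theorem.** (i) Let $\langle A,B\rangle=-\tfrac12\operatorname{tr}(AB)$ on $\mathfrak{so}(n)=\mathfrak{so}(n,\mathbb R)$, and let $S^2(\mathfrak{so}(n))$ be the space of endomorphisms of $\mathfrak{so}(n)$ that are symmetric with respect to $\langle\cdot,\cdot\rangle$. Extend $\langle\cdot,\cdot\rangle$ to a Hermitian form on $\mathfrak{so}(n,\mathbb C)=\mathfrak{so}(n)\otimes\mathbb C$, and each $R\in S^2(\mathfrak{so}(n))$ to a complex-linear endomorphism of $\mathfrak{so}(n,\mathbb C)$. For $S\subset\mathfrak{so}(n,\mathbb C)$ put $$C(S)=\{R\in S^2(\mathfrak{so}(n)) : \langle R(X),X\rangle\ge 0\ \text{ for all } X\in S\},$$ and let $S_0=\{X\in\mathfrak{so}(n,\mathbb C): \operatorname{rank}X=2,\ X^2=0\}$, so that $C(S_0)$ is the cone of curvature operators with nonnegative isotropic curvature. Let $S\subset\mathfrak{so}(n,\mathbb C)$ be an $\mathrm{Ad}_{SO(n,\mathbb C)}$-invariant set containing a nonzero element; if $n=4$, assume moreover that $S$ spans $\mathfrak{so}(4,\mathbb C)$ over $\mathbb C$.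 Then $C(S)\subset C(S_0)$. Moreover, if $R\in S^2(\mathfrak{so}(n))$ satisfies $\langle R(X),X\rangle=0$ for all $X\in S$, then $\langle R(Y),Y\rangle=0$ for all $Y\in S_0$. (ii) Let $\mathfrak u(n)$ be the space of skew-Hermitian complex $n\times n$ matrices with the inner product $\langle A,B\rangle=-\operatorname{Re}\operatorname{tr}(AB)$ (the restriction of the inner product of $\mathfrak{so}(2n)$), and let $S^2(\mathfrak u(n))$ be the space of its symmetric endomorphisms. Extend $\langle\cdot,\cdot\rangle$ to a Hermitian form on $\mathfrak{gl}(n,\mathbb C)=\mathfrak u(n)\otimes\mathbb C$, and each $R\in S^2(\mathfrak u(n))$ to a complex-linear endomorphism of $\mathfrak{gl}(n,\mathbb C)$. For $S\subset\mathfrak{gl}(n,\mathbb C)$ put $$C^K(S)=\{R\in S^2(\mathfrak u(n)) : \langle R(X),X\rangle\ge 0\ \text{ for all } X\in S\},$$ and let $S_1=\{X\in\mathfrak{gl}(n,\mathbb C): \operatorname{rank}X=1,\ X^2=0\}$, so that $C^K(S_1)$ is the cone of Kähler curvature operators with nonnegative orthogonal bisectional curvature. Let $S\subset\mathfrak{gl}(n,\mathbb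 C)$ be an $\mathrm{Ad}_{GL(n,\mathbb C)}$-invariant set containing a matrix that is not a scalar multiple of the identity. Then $C^K(S)\subset C^K(S_1)$. Moreover, if $R\in S^2(\mathfrak u(n))$ satisfies $\langle R(X),X\rangle=0$ for all $X\in S$, then $\langle R(Y),Y\rangle=0$ for all $Y\in S_1$. -/

import Mathlib

open scoped ComplexOrder

namespace WilkingCone

noncomputable section

/-- `𝔰𝔬(n, R)`: the `n × n` matrices over `R` with `Aᵀ = -A`. -/
def so (n : ℕ) (R : Type) [CommRing R] : Submodule R (Matrix (Fin n) (Fin n) R) where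
  carrier := {A | A.transpose = -A}
  add_mem' {A B} hA hB := by
    change (A + B).transpose = -(A + B)
    rw [Matrix.transpose_add, show A.transpose = -A from hA, show B.transpose = -B from hB,
      neg_add]
  zero_mem' := by simp
  smul_mem' c A hA := by
    change (c • A).transpose = -(c • A)
    rw [Matrix.transpose_smul, show A.transpose = -A from hA, smul_neg]

theorem mem_so {n : ℕ} {R : Type} [CommRing R] {A : Matrix (Fin n) (Fin n) R} :
    A ∈ so n R ↔ A.transpose = -A :=
  Iff.rfl

/-- `𝔲(n)`: the real vector space of complex `n × n` matrices with `Aᴴ = -A`. -/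
abbrev u (n : ℕ) : Submodule ℝ (Matrix (Fin n) (Fin n) ℂ) :=
  skewAdjoint.submodule ℝ (Matrix (Fin n) (Fin n) ℂ)

/-! ### The Riemannian case -/

/-- The inner product `⟨A, B⟩ = -½ tr (A B)` on `𝔰𝔬(n, ℝ)`. -/
def innerSo {n : ℕ} (A B : so n ℝ) : ℝ :=
  -(1 / 2) * ((A : Matrix (Fin n) (Fin n) ℝ) * (B : Matrix (Fin n) (Fin n) ℝ)).trace

/-- `S²(𝔰𝔬(n))`: the endomorphisms of `𝔰𝔬(n, ℝ)` that are symmetric for `innerSo`. -/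
def symSo (n : ℕ) : Set (so n ℝ →ₗ[ℝ] so n ℝ) :=
  {R | ∀ A B, innerSo (R A) B = innerSo A (R B)}

/-- The entrywise real part of an element of `𝔰𝔬(n, ℂ)`. -/
def reSo {n : ℕ} (X : so n ℂ) : so n ℝ :=
  ⟨(X : Matrix (Fin n) (Fin n) ℂ).map Complex.re, by
    have h := mem_so.1 X.2
    rw [mem_so]
    ext i j
    simpa using congrArg Complex.re (congrFun (congrFun h i) j)⟩

/-- The entrywise imaginary part of an element of `𝔰𝔬(n, ℂ)`. -/
def imSo {n : ℕ} (X : so n ℂ) : so n ℝ :=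
  ⟨(X : Matrix (Fin n) (Fin n) ℂ).map Complex.im, by
    have h := mem_so.1 X.2
    rw [mem_so]
    ext i j
    simpa using congrArg Complex.im (congrFun (congrFun h i) j)⟩

/-- The inclusion `𝔰𝔬(n, ℝ) ⊆ 𝔰𝔬(n, ℂ)`. -/
def ofRealSo {n : ℕ} (A : so n ℝ) : so n ℂ :=
  ⟨(A : Matrix (Fin n) (Fin n) ℝ).map Complex.ofReal, by
    have h := mem_so.1 A.2
    rw [mem_so]
    ext i j
    simpa using congrArg Complex.ofReal (congrFun (congrFun h i) j)⟩

/-- The complex-linear extension of an endomorphism of `𝔰𝔬(n, ℝ)` to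
`𝔰𝔬(n, ℂ) = 𝔰𝔬(n, ℝ) ⊗ ℂ`: it sends `A + i B` to `R A + i R B`. -/
def extendSo {n : ℕ} (R : so n ℝ →ₗ[ℝ] so n ℝ) : so n ℂ →ₗ[ℂ] so n ℂ where
  toFun X := ofRealSo (R (reSo X)) + Complex.I • ofRealSo (R (imSo X))
  map_add' X Y := by
    have h1 : reSo (X + Y) = reSo X + reSo Y := by ext i j; simp [reSo]
    have h2 : imSo (X + Y) = imSo X + imSo Y := by ext i j; simp [imSo]
    rw [h1, h2, map_add, map_add]
    ext i j
    simp [ofRealSo]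
    ring
  map_smul' c X := by
    have h1 : reSo (c • X) = c.re • reSo X - c.im • imSo X := by
      ext i j; simp [reSo, imSo]
    have h2 : imSo (c • X) = c.re • imSo X + c.im • reSo X := by
      ext i j; simp [reSo, imSo]
    rw [h1, h2, map_add, map_sub, map_smul, map_smul, map_smul, map_smul]
    ext i j
    apply Complex.ext <;> simp [ofRealSo] <;> ring

/-- The Hermitian extension of `innerSo` to `𝔰𝔬(n, ℂ)`: `⟨X, Y⟩ = -½ tr (X Ȳ)`. -/
def hermSo {n : ℕ} (X Y : so n ℂ) : ℂ :=
  -(1 / 2) * ((X : Matrix (Fin n) (Fin n) ℂ) *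
    (Y : Matrix (Fin n) (Fin n) ℂ).map (starRingEnd ℂ)).trace

/-- The cone `C(S)` of all `R ∈ S²(𝔰𝔬(n))` with `⟨R(X), X⟩ ≥ 0` for all `X ∈ S`. -/
def coneSo {n : ℕ} (S : Set (so n ℂ)) : Set (so n ℝ →ₗ[ℝ] so n ℝ) :=
  {R | R ∈ symSo n ∧ ∀ X ∈ S, 0 ≤ hermSo (extendSo R X) X}

/-- The adjoint action `X ↦ P X P⁻¹` of `SO(n, ℂ)` on `𝔰𝔬(n, ℂ)`. -/
def adSO {n : ℕ} (P : Matrix.specialOrthogonalGroup (Fin n) ℂ) (X : so n ℂ) : so n ℂ :=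
  ⟨(P : Matrix (Fin n) (Fin n) ℂ) * (X : Matrix (Fin n) (Fin n) ℂ) *
      (P : Matrix (Fin n) (Fin n) ℂ)⁻¹, by
    have h := mem_so.1 X.2
    have hP := (Matrix.mem_orthogonalGroup_iff (Fin n) ℂ).1
      (Matrix.mem_specialOrthogonalGroup_iff.1 P.2).1
    rw [mem_so, Matrix.inv_eq_right_inv hP]
    simp [Matrix.transpose_mul, h, Matrix.mul_assoc]⟩

/-- `S₀`: the `X ∈ 𝔰𝔬(n, ℂ)` of rank `2` with `X² = 0`; `coneSo (isotropicSet n)` is the cone of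
curvature operators with nonnegative isotropic curvature. -/
def isotropicSet (n : ℕ) : Set (so n ℂ) :=
  {X | (X : Matrix (Fin n) (Fin n) ℂ).rank = 2 ∧ (X : Matrix (Fin n) (Fin n) ℂ) ^ 2 = 0}

/-! ### The Kähler case -/

/-- The inner product on `𝔲(n)`, viewed inside `𝔰𝔬(2n, ℝ)`: the real trace of a complex matrix
acting on `ℂⁿ = ℝ²ⁿ` is twice the real part of its complex trace, so `-½ tr (A B)` becomes
`-Re tr (A B)`. -/
def innerU {n : ℕ} (A B : u n) : ℝ :=
  -((A : Matrix (Fin n) (Fin n) ℂ) * (B : Matrix (Fin n) (Fin n) ℂ)).trace.re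

/-- `S²(𝔲(n))`: the endomorphisms of `𝔲(n)` that are symmetric for `innerU`. -/
def symU (n : ℕ) : Set (u n →ₗ[ℝ] u n) :=
  {R | ∀ A B, innerU (R A) B = innerU A (R B)}

/-- The `𝔲(n)`-real part `(X - Xᴴ) / 2` of `X ∈ 𝔤𝔩(n, ℂ) = 𝔲(n) ⊕ i 𝔲(n)`. -/
def reU {n : ℕ} (X : Matrix (Fin n) (Fin n) ℂ) : u n :=
  ⟨(1 / 2 : ℝ) • (X - X.conjTranspose), by
    change star _ = -_
    rw [Matrix.star_eq_conjTranspose, Matrix.conjTranspose_smul, Matrix.conjTranspose_sub,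
      Matrix.conjTranspose_conjTranspose, ← smul_neg, neg_sub, star_trivial]⟩

/-- The `𝔲(n)`-imaginary part of `X ∈ 𝔤𝔩(n, ℂ) = 𝔲(n) ⊕ i 𝔲(n)`: the `𝔲(n)`-real part of
`-i X`, that is `(X + Xᴴ) / (2 i)`. -/
def imU {n : ℕ} (X : Matrix (Fin n) (Fin n) ℂ) : u n :=
  reU (-Complex.I • X)

theorem reU_add_I_smul_imU {n : ℕ} (X : Matrix (Fin n) (Fin n) ℂ) :
    (reU X : Matrix (Fin n) (Fin n) ℂ) + Complex.I • (imU X : Matrix (Fin n) (Fin n) ℂ) = X := by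
  ext i j
  apply Complex.ext <;> simp [reU, imU] <;> ring

/-- The complex-linear extension of an endomorphism of `𝔲(n)` to `𝔤𝔩(n, ℂ) = 𝔲(n) ⊗ ℂ`: it sends
`A + i B` to `R A + i R B`. -/
def extendU {n : ℕ} (R : u n →ₗ[ℝ] u n) :
    Matrix (Fin n) (Fin n) ℂ →ₗ[ℂ] Matrix (Fin n) (Fin n) ℂ where
  toFun X := (R (reU X) : Matrix (Fin n) (Fin n) ℂ) +
    Complex.I • (R (imU X) : Matrix (Fin n) (Fin n) ℂ)
  map_add' X Y := by
    have h1 : reU (X + Y) = reU X + reU Y := by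
      ext i j; apply Complex.ext <;> simp [reU] <;> ring
    have h2 : imU (X + Y) = imU X + imU Y := by
      ext i j; apply Complex.ext <;> simp [imU, reU] <;> ring
    rw [h1, h2, map_add, map_add]
    ext i j
    simp
    ring
  map_smul' c X := by
    have h1 : reU (c • X) = c.re • reU X - c.im • imU X := by
      ext i j; apply Complex.ext <;> simp [imU, reU] <;> ring
    have h2 : imU (c • X) = c.re • imU X + c.im • reU X := by
      ext i j; apply Complex.ext <;> simp [imU, reU] <;> ring
    rw [h1, h2, map_add, map_sub, map_smul, map_smul, map_smul, map_smul]
    ext i j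
    apply Complex.ext <;> simp <;> ring

/-- The Hermitian extension of `innerU` to `𝔤𝔩(n, ℂ)`. As the conjugation of `𝔤𝔩(n, ℂ)` with
respect to `𝔲(n)` is `Y ↦ -Yᴴ`, it is `⟨X, Y⟩ = tr (X Yᴴ)`. -/
def hermU {n : ℕ} (X Y : Matrix (Fin n) (Fin n) ℂ) : ℂ :=
  (X * Y.conjTranspose).trace

/-- The cone `Cᴷ(S)` of all `R ∈ S²(𝔲(n))` with `⟨R(X), X⟩ ≥ 0` for all `X ∈ S`. -/
def coneU {n : ℕ} (S : Set (Matrix (Fin n) (Fin n) ℂ)) : Set (u n →ₗ[ℝ] u n) :=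
  {R | R ∈ symU n ∧ ∀ X ∈ S, 0 ≤ hermU (extendU R X) X}

/-- The adjoint action `X ↦ P X P⁻¹` of `GL(n, ℂ)` on `𝔤𝔩(n, ℂ)`. -/
def adGL {n : ℕ} (P : Matrix.GeneralLinearGroup (Fin n) ℂ) (X : Matrix (Fin n) (Fin n) ℂ) :
    Matrix (Fin n) (Fin n) ℂ :=
  (P : Matrix (Fin n) (Fin n) ℂ) * X * (P : Matrix (Fin n) (Fin n) ℂ)⁻¹

/-- `S₁`: the `X ∈ 𝔤𝔩(n, ℂ)` of rank `1` with `X² = 0`; `coneU (orthBisectionalSet n)` is the cone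
of Kähler curvature operators with nonnegative orthogonal bisectional curvature. -/
def orthBisectionalSet (n : ℕ) : Set (Matrix (Fin n) (Fin n) ℂ) :=
  {X | X.rank = 1 ∧ X ^ 2 = 0}

end

end WilkingCone

/-!
Write `q(X) = ⟨R(X), X⟩`. This is a continuous function with `q(cX) = |c|² q(X)`, so the set of all
`X` with `q(X) ≥ 0` (or with `q(X) = 0`) is a closed complex cone, and both halves of each part
follow from one fact: the closed complex cone generated by the invariant set `S` contains every
element `Y` of the model set `S₀`, respectively `S₁`.

To reach `Y`, contract along a torus. If `p` and `r` are idempotents with `p r = r p = 0`, then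
`T(t) = 1 + (t - 1) p + (t⁻¹ - 1) r` is a multiplicative one-parameter group, and
`t⁻² T(t) X T(t)⁻¹` tends to `p X r` as `t → ∞` (`tendsto_torus_conj`).

* For `Y ∈ S₀`, the range of `Y` is an isotropic plane. Take an `n × 2` matrix `U` with columns a
  unitary basis of it, `p = U Uᴴ` the unitary projection and `r = pᵀ`. Then `T(t) ∈ SO(n, ℂ)`, and
  `p X pᵀ` and `Y` are both multiples of `U J Uᵀ`, with `J` the standard skew `2 × 2` matrix
  (`isotropic_normal_form`). It remains to find `X ∈ S` for which `p X pᵀ ≠ 0`. This is a linear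
  condition on `X` which fails to vanish identically, so it suffices that `S` spans `𝔰𝔬(n, ℂ)`.
  For `n = 4` that is assumed, for `n ≥ 5` it holds because `𝔰𝔬(n, ℂ)` is an irreducible
  `SO(n, ℂ)`-module (`so_irreducible`), and for `n ≤ 3` the set `S₀` is empty.
* For `Y ∈ S₁`, one has `Y = c x yᴴ` with `x`, `y` orthonormal (`orthBisectional_normal_form`). Take
  `p = x xᴴ` and `r = y yᴴ`, so that `p X r = (xᴴ X y) x yᴴ`. A nonscalar `X` has a vector `v` for
  which `v` and `X v` are independent; conjugating `X` by an invertible matrix that carries these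
  to `y` and `x` makes `xᴴ X y` nonzero (`exists_GL_pairing_ne_zero`).
-/

namespace WilkingCone

open Matrix Filter Topology

variable {n : ℕ}

/-! ### Unitary bases of the range of a matrix -/

/-- The columns of `U` are a unitary basis of the column space of `Y`: `U * Uᴴ` is the orthogonal
projection onto that space, which fixes `Y`, and `U` factors through `Y`. -/
theorem exists_isometry_range {m n r : ℕ} (Y : Matrix (Fin m) (Fin n) ℂ) (h : Y.rank = r) :
    ∃ U : Matrix (Fin m) (Fin r) ℂ, Uᴴ * U = 1 ∧ U * Uᴴ * Y = Y ∧
      ∃ W : Matrix (Fin n) (Fin r) ℂ, U = Y * W := by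
  have hr : Module.finrank ℂ (LinearMap.range (toEuclideanLin Y)) = r := by
    rw [← h, Matrix.rank_eq_finrank_range_toLin Y (EuclideanSpace.basisFun (Fin m) ℂ).toBasis
      (EuclideanSpace.basisFun (Fin n) ℂ).toBasis, toEuclideanLin_eq_toLin_orthonormal]
  let b := (stdOrthonormalBasis ℂ (LinearMap.range (toEuclideanLin Y))).reindex (finCongr hr)
  choose w hw using fun j => (b j).2
  refine ⟨Matrix.of fun i j => (b j : EuclideanSpace ℂ (Fin m)) i, ?_, ?_,
    Matrix.of fun i j => w j i, ?_⟩
  · ext i j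
    have := orthonormal_iff_ite.1 b.orthonormal i j
    rw [Submodule.coe_inner, PiLp.inner_apply] at this
    simp only [mul_apply, conjTranspose_apply, of_apply, one_apply]
    rw [← this]
    exact Finset.sum_congr rfl fun k _ => by simp [mul_comm]
  · ext i j
    have := b.sum_repr' ⟨toEuclideanLin Y (EuclideanSpace.single j 1), LinearMap.mem_range_self _ _⟩
    have := congrArg (fun z : LinearMap.range (toEuclideanLin Y) =>
      (z : EuclideanSpace ℂ (Fin m)) i) this
    simp only [Submodule.coe_inner, PiLp.inner_apply] at this
    simp [toLpLin_apply, mulVec_single] at this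
    rw [← this, Matrix.mul_assoc]
    simp [mul_apply, Finset.mul_sum, mul_comm, mul_left_comm]
  · ext i j
    have := congrArg (fun z : EuclideanSpace ℂ (Fin m) => z i) (hw j)
    simpa [toLpLin_apply, mulVec, dotProduct, mul_apply] using this.symm

/-! ### Contraction along a torus -/

section Torus

variable {A : Type*} [Ring A] [Algebra ℂ A]

/-- For idempotents `p`, `q` with `p q = q p = 0`, the element acting by `t` on the image of `p`, by
`t⁻¹` on that of `q`, and trivially on that of `1 - p - q`. -/
noncomputable def torus (p q : A) (t : ℂ) : A := 1 + (t - 1) • p + (t⁻¹ - 1) • q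

theorem torus_comm (p q : A) (t : ℂ) : torus p q t⁻¹ = torus q p t := by
  simp only [torus, inv_inv]; abel

theorem torus_one (p q : A) : torus p q 1 = 1 := by simp [torus]

theorem torus_mul {p q : A} (hp : p * p = p) (hq : q * q = q) (hpq : p * q = 0) (hqp : q * p = 0)
    (t u : ℂ) : torus p q t * torus p q u = torus p q (t * u) := by
  simp only [torus, add_mul, mul_add, one_mul, mul_one, smul_mul_smul_comm, hp, hq, hpq, hqp,
    smul_zero, mul_inv]
  module

theorem torus_mul_swap {p q : A} (hp : p * p = p) (hq : q * q = q) (hpq : p * q = 0)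
    (hqp : q * p = 0) {t : ℂ} (ht : t ≠ 0) : torus p q t * torus q p t = 1 := by
  rw [← torus_comm p q, torus_mul hp hq hpq hqp, mul_inv_cancel₀ ht, torus_one]

end Torus

/-- The parameter is `t = s ^ 2`, for which `torus_mem_SO` gives determinant `1`. -/
theorem tendsto_inv_smul_torus (p q : Matrix (Fin n) (Fin n) ℂ) :
    Tendsto (fun s : ℝ => ((s ^ 2 : ℝ) : ℂ)⁻¹ • torus p q ((s ^ 2 : ℝ) : ℂ)) atTop (𝓝 p) := by
  have h0 : Tendsto (fun s : ℝ => ((s ^ 2 : ℝ) : ℂ)⁻¹) atTop (𝓝 0) := by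
    have := (tendsto_inv_atTop_zero (𝕜 := ℝ)).comp (tendsto_pow_atTop (α := ℝ) (two_ne_zero))
    have := (Complex.continuous_ofReal.tendsto 0).comp this
    simpa [Function.comp_def] using this
  have h1 : Tendsto (fun s : ℝ => ((s ^ 2 : ℝ) : ℂ)⁻¹ • (1 - p - q) + p +
      (((s ^ 2 : ℝ) : ℂ)⁻¹ * ((s ^ 2 : ℝ) : ℂ)⁻¹) • q) atTop
      (𝓝 ((0 : ℂ) • (1 - p - q) + p + ((0 : ℂ) * 0) • q)) :=
    ((h0.smul_const _).add_const _).add ((h0.mul h0).smul_const _)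
  rw [zero_smul, zero_add, mul_zero, zero_smul, add_zero] at h1
  refine h1.congr' ?_
  filter_upwards [eventually_gt_atTop 0] with s hs
  have : ((s ^ 2 : ℝ) : ℂ) ≠ 0 := by exact_mod_cast (pow_pos hs 2).ne'
  generalize ((s ^ 2 : ℝ) : ℂ) = t at *
  have h2 : t⁻¹ • ((t - 1) • p) = p - t⁻¹ • p := by
    rw [smul_smul, mul_sub, inv_mul_cancel₀ this]; module
  simp only [torus, smul_add, h2]
  module

/-- `torus q p t` is the inverse of `torus p q t`, by `torus_mul_swap`, so the matrices in the limit
are rescaled conjugates of `X`. -/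
theorem tendsto_torus_conj (p q X : Matrix (Fin n) (Fin n) ℂ) :
    Tendsto (fun s : ℝ => (((s ^ 2 : ℝ) : ℂ)⁻¹ * ((s ^ 2 : ℝ) : ℂ)⁻¹) •
      (torus p q ((s ^ 2 : ℝ) : ℂ) * X * torus q p ((s ^ 2 : ℝ) : ℂ))) atTop
      (𝓝 (p * X * q)) := by
  refine (((tendsto_inv_smul_torus p q).mul_const X).mul (tendsto_inv_smul_torus q p)).congr
    fun s => ?_
  simp only [smul_mul_assoc, mul_smul_comm, smul_smul]

/-! ### Limits and multiples under a homogeneous form -/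

/-- The condition `q X ∈ K`, for `q` homogeneous and `K` a closed cone, passes to limits of rescaled
elements; `K` will be `{z | 0 ≤ z}` or `{0}`. -/
theorem mem_of_tendsto_smul {V : Type*} [TopologicalSpace V] [SMul ℂ V] {q : V → ℂ}
    (hq : Continuous q) (hs : ∀ (c : ℂ) X, q (c • X) = (Complex.normSq c : ℂ) * q X)
    {K : Set ℂ} (hK : IsClosed K) (hKs : ∀ r : ℝ, 0 ≤ r → ∀ z ∈ K, (r : ℂ) * z ∈ K)
    {c : ℝ → ℂ} {Z : ℝ → V} {L : V} (h : Tendsto (fun s => c s • Z s) atTop (𝓝 L))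
    (hZ : ∀ s > 0, q (Z s) ∈ K) : q L ∈ K := by
  refine hK.mem_of_tendsto ((hq.tendsto L).comp h) ?_
  filter_upwards [eventually_gt_atTop 0] with s h0
  simp only [Function.comp_apply, hs]
  exact hKs _ (Complex.normSq_nonneg _) _ (hZ s h0)

theorem mem_of_smul_mem {V : Type*} [AddCommGroup V] [Module ℂ V] {q : V → ℂ}
    (hs : ∀ (c : ℂ) X, q (c • X) = (Complex.normSq c : ℂ) * q X)
    {K : Set ℂ} (hKs : ∀ r : ℝ, 0 ≤ r → ∀ z ∈ K, (r : ℂ) * z ∈ K)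
    {d : ℂ} (hd : d ≠ 0) (c : ℂ) {X : V} (h : q (d • X) ∈ K) : q (c • X) ∈ K := by
  rw [show c • X = (c * d⁻¹) • d • X by rw [smul_smul, mul_assoc, inv_mul_cancel₀ hd, mul_one], hs]
  exact hKs _ (Complex.normSq_nonneg _) _ h

/-! ### Irreducibility of the complex orthogonal Lie algebra -/

theorem inv_eq_transpose (P : specialOrthogonalGroup (Fin n) ℂ) :
    (P : Matrix (Fin n) (Fin n) ℂ)⁻¹ = (P : Matrix (Fin n) (Fin n) ℂ)ᵀ :=
  inv_eq_right_inv ((mem_orthogonalGroup_iff (Fin n) ℂ).1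
    (mem_specialOrthogonalGroup_iff.1 P.2).1)

theorem so_apply (X : so n ℂ) (i j : Fin n) :
    (X : Matrix (Fin n) (Fin n) ℂ) j i = -(X : Matrix (Fin n) (Fin n) ℂ) i j :=
  congrFun (congrFun (mem_so.1 X.2) i) j

/-- The sign vector which is `-1` exactly at `a` and `b` when `a ≠ b`; its entries always multiply to
`1`. -/
def signFlip (a b x : Fin n) : ℂ := (if x = a then -1 else 1) * (if x = b then -1 else 1)

/-- The diagonal matrix of `signFlip a b`, as an element of `SO(n, ℂ)`. -/
def signFlipSO (a b : Fin n) : specialOrthogonalGroup (Fin n) ℂ :=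
  ⟨diagonal (signFlip a b), mem_specialOrthogonalGroup_iff.2
    ⟨(mem_orthogonalGroup_iff (Fin n) ℂ).2 (by
      rw [diagonal_transpose, diagonal_mul_diagonal, ← diagonal_one]
      congr 1; ext x; simp only [signFlip]; split_ifs <;> norm_num), by
    rw [det_diagonal]
    simp only [signFlip, Finset.prod_mul_distrib, Finset.prod_ite_eq', Finset.mem_univ, if_true]
    norm_num⟩⟩

theorem adSO_signFlipSO_apply (a b : Fin n) (X : so n ℂ) (k l : Fin n) :
    (adSO (signFlipSO a b) X : Matrix (Fin n) (Fin n) ℂ) k l =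
      signFlip a b k * signFlip a b l * (X : Matrix (Fin n) (Fin n) ℂ) k l := by
  simp only [adSO, inv_eq_transpose]
  simp only [signFlipSO, diagonal_transpose, mul_diagonal, diagonal_mul]
  ring

/-- The permutation matrix of an even permutation, as an element of `SO(n, ℂ)`. -/
def permSO (σ : alternatingGroup (Fin n)) : specialOrthogonalGroup (Fin n) ℂ :=
  ⟨(σ : Equiv.Perm (Fin n)).permMatrix ℂ, mem_specialOrthogonalGroup_iff.2
    ⟨(mem_orthogonalGroup_iff (Fin n) ℂ).2 (by
      rw [Matrix.transpose_permMatrix, ← Matrix.permMatrix_mul]; simp), by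
    rw [det_permutation, Equiv.Perm.mem_alternatingGroup.1 σ.2]; simp⟩⟩

theorem adSO_permSO_apply (σ : alternatingGroup (Fin n)) (X : so n ℂ) (k l : Fin n) :
    (adSO (permSO σ) X : Matrix (Fin n) (Fin n) ℂ) k l =
      (X : Matrix (Fin n) (Fin n) ℂ) ((σ : Equiv.Perm (Fin n)) k) ((σ : Equiv.Perm (Fin n)) l) := by
  simp only [adSO, inv_eq_transpose]
  simp only [permSO, transpose_permMatrix]
  simp [Equiv.Perm.permMatrix, PEquiv.toMatrix_toPEquiv_mul, PEquiv.mul_toMatrix_toPEquiv,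
    Equiv.Perm.inv_def]

/-- Distinct positions above the diagonal are separated by characters of the group of diagonal sign
matrices of determinant `1`. This fails for `n = 4`, where the positions `(0, 1)` and `(2, 3)` have
the same character. -/
theorem exists_signFlip (hn : 5 ≤ n) {i j k l : Fin n} (hij : i ≠ j) (hkl : k ≠ l)
    (h1 : ¬(k = i ∧ l = j)) (h2 : ¬(k = j ∧ l = i)) :
    ∃ a b, signFlip a b i * signFlip a b j = 1 ∧ signFlip a b k * signFlip a b l = -1 := by
  by_cases hk : k = i ∨ k = j ∨ l = i ∨ l = j
  · refine ⟨i, j, ?_, ?_⟩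
    · simp [signFlip, hij, hij.symm]
    · rcases hk with rfl | rfl | rfl | rfl <;> simp_all [signFlip, eq_comm]
  · push Not at hk
    obtain ⟨r, hr⟩ : ∃ r, r ∉ ({i, j, k, l} : Finset (Fin n)) := by
      by_contra! h
      have := Finset.card_le_card (fun x _ => h x : (Finset.univ : Finset (Fin n)) ⊆ _)
      have h4 := Finset.card_le_four (a := i) (b := j) (c := k) (d := l)
      simp at this
      omega
    simp only [Finset.mem_insert, Finset.mem_singleton, not_or] at hr
    refine ⟨l, r, ?_, ?_⟩
    · simp [signFlip, hk.2.2.1.symm, hk.2.2.2.symm, Ne.symm hr.1, Ne.symm hr.2.1]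
    · simp [signFlip, hkl, Ne.symm hr.2.2.1, Ne.symm hr.2.2.2]

/-- The element `E_kl - E_lk` of `𝔰𝔬(n, ℂ)`, which is `0` for `k = l`. -/
def skewUnit (k l : Fin n) : so n ℂ :=
  ⟨single k l 1 - single l k 1, by rw [mem_so, transpose_sub, transpose_single, transpose_single,
    neg_sub]⟩

theorem eq_sum_skewUnit (Z : so n ℂ) :
    Z = ∑ k, ∑ l, ((Z : Matrix (Fin n) (Fin n) ℂ) k l / 2) • skewUnit k l := by
  have h1 := matrix_eq_sum_single (of fun k l => (Z : Matrix (Fin n) (Fin n) ℂ) k l / 2)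
  have h2 := matrix_eq_sum_single (of fun l k => (Z : Matrix (Fin n) (Fin n) ℂ) k l / 2)
  simp only [of_apply] at h1 h2
  apply Subtype.ext
  simp only [Submodule.coe_sum, Submodule.coe_smul, skewUnit, smul_sub, Finset.sum_sub_distrib,
    smul_single, smul_eq_mul, mul_one]
  rw [← h1, Finset.sum_comm, ← h2]
  ext i j
  simp only [Matrix.sub_apply, of_apply]
  rw [so_apply Z i j]
  ring

theorem exists_alternating (hn : 4 ≤ n) {i j k l : Fin n} (hij : i ≠ j) (hkl : k ≠ l) :
    ∃ σ : alternatingGroup (Fin n), (σ : Equiv.Perm (Fin n)) k = i ∧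
      (σ : Equiv.Perm (Fin n)) l = j := by
  have := alternatingGroup.isMultiplyPretransitive (Fin n)
  have : MulAction.IsMultiplyPretransitive (alternatingGroup (Fin n)) (Fin n) 2 :=
    MulAction.isMultiplyPretransitive_of_le (n := Nat.card (Fin n) - 2) (by simp; omega)
      (by simp)
  exact MulAction.is_two_pretransitive_iff.1 this hkl hij

/-- `𝔰𝔬(n, ℂ)` is an irreducible `SO(n, ℂ)`-module for `n ≥ 5`. An element of `N` with the fewest
nonzero entries must be a multiple of some `E_ij - E_ji`, since adding to `X` its conjugate by a sign
matrix kills entries; even permutations then give all the others. -/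
theorem so_irreducible (hn : 5 ≤ n) (N : Submodule ℂ (so n ℂ))
    (hN : ∀ (P : specialOrthogonalGroup (Fin n) ℂ), ∀ X ∈ N, adSO P X ∈ N)
    (hne : ∃ X ∈ N, X ≠ 0) : N = ⊤ := by
  let supp : so n ℂ → Finset (Fin n × Fin n) := fun X =>
    Finset.univ.filter fun p => (X : Matrix (Fin n) (Fin n) ℂ) p.1 p.2 ≠ 0
  obtain ⟨X, ⟨hX, hX0⟩, hmin⟩ := (measure fun X => (supp X).card).wf.has_min
    {X | X ∈ N ∧ X ≠ 0} hne
  obtain ⟨i, j, hXij⟩ : ∃ i j, (X : Matrix (Fin n) (Fin n) ℂ) i j ≠ 0 := by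
    by_contra! h
    exact hX0 (Subtype.ext (Matrix.ext h))
  have hdiag (k : Fin n) : (X : Matrix (Fin n) (Fin n) ℂ) k k = 0 := self_eq_neg.1 (so_apply X k k)
  have hij : i ≠ j := by rintro rfl; exact hXij (hdiag i)
  -- Otherwise `X + D X D⁻¹`, for a sign matrix `D`, keeps the entry `(i, j)` and loses `(k, l)`.
  have hzero (k l : Fin n) (h1 : ¬(k = i ∧ l = j)) (h2 : ¬(k = j ∧ l = i)) :
      (X : Matrix (Fin n) (Fin n) ℂ) k l = 0 := by
    by_contra hXkl
    have hkl : k ≠ l := by rintro rfl; exact hXkl (hdiag k)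
    obtain ⟨a, b, hab1, hab2⟩ := exists_signFlip hn hij hkl h1 h2
    have happ (x y : Fin n) : ((X + adSO (signFlipSO a b) X : so n ℂ) :
        Matrix (Fin n) (Fin n) ℂ) x y = (1 + signFlip a b x * signFlip a b y) *
          (X : Matrix (Fin n) (Fin n) ℂ) x y := by
      rw [Submodule.coe_add, Matrix.add_apply, adSO_signFlipSO_apply]; ring
    refine hmin (X + adSO (signFlipSO a b) X) ⟨N.add_mem hX (hN _ _ hX), fun h => ?_⟩
      (Finset.card_lt_card (Finset.ssubset_iff_of_subset ?_ |>.2 ⟨(k, l), ?_, ?_⟩))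
    · have := happ i j
      rw [h, hab1] at this
      simp [hXij] at this
    · intro p hp
      simp only [supp, Finset.mem_filter, Finset.mem_univ, true_and, happ] at hp ⊢
      exact right_ne_zero_of_mul hp
    · simpa [supp] using hXkl
    · simp [supp, happ, hab2]
  have hunit : X = (X : Matrix (Fin n) (Fin n) ℂ) i j • skewUnit i j := by
    ext k l
    simp only [Submodule.coe_smul, skewUnit, Matrix.smul_apply, Matrix.sub_apply, single_apply,
      smul_eq_mul]
    by_cases h1 : k = i ∧ l = j
    · simp [h1.1, h1.2, hij]
    by_cases h2 : k = j ∧ l = i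
    · simp [h2.1, h2.2, hij, so_apply X i j]
    · rw [hzero k l h1 h2, if_neg (by tauto), if_neg (by tauto)]; simp
  have hmem : skewUnit i j ∈ N := by
    rw [hunit] at hX
    exact (N.smul_mem_iff hXij).1 hX
  rw [eq_top_iff]
  intro Z _
  rw [eq_sum_skewUnit Z]
  refine N.sum_mem fun k _ => N.sum_mem fun l _ => N.smul_mem _ ?_
  by_cases hkl : k = l
  · rw [show skewUnit k l = 0 by ext; simp [skewUnit, hkl]]
    exact N.zero_mem
  obtain ⟨σ, rfl, rfl⟩ := exists_alternating (by omega) hij hkl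
  convert hN (permSO σ) _ hmem
  ext x y
  rw [adSO_permSO_apply]
  simp [skewUnit, single_apply]

/-! ### Nonnegative isotropic curvature -/

theorem continuous_hermSo_extendSo (R : so n ℝ →ₗ[ℝ] so n ℝ) :
    Continuous fun X => hermSo (extendSo R X) X := by
  have h1 : Continuous (extendSo R) := LinearMap.continuous_of_finiteDimensional _
  refine continuous_const.mul (Continuous.matrix_trace ?_)
  exact (continuous_subtype_val.comp h1).matrix_mul
    (continuous_subtype_val.matrix_map Complex.continuous_conj)

theorem hermSo_extendSo_smul (R : so n ℝ →ₗ[ℝ] so n ℝ) (c : ℂ) (X : so n ℂ) :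
    hermSo (extendSo R (c • X)) (c • X) = (Complex.normSq c : ℂ) * hermSo (extendSo R X) X := by
  have : ((c • X : so n ℂ) : Matrix (Fin n) (Fin n) ℂ).map (starRingEnd ℂ) =
      starRingEnd ℂ c • (X : Matrix (Fin n) (Fin n) ℂ).map (starRingEnd ℂ) := by
    ext; simp
  rw [hermSo, this, map_smul, Submodule.coe_smul, smul_mul_smul_comm, trace_smul, Complex.mul_conj,
    smul_eq_mul, hermSo]
  ring

/-- The standard skew-symmetric `2 × 2` matrix, which spans `𝔰𝔬(2, ℂ)`. -/
def stdSkew : Matrix (Fin 2) (Fin 2) ℂ := !![0, 1; -1, 0]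

theorem eq_smul_stdSkew {M : Matrix (Fin 2) (Fin 2) ℂ} (h : Mᵀ = -M) : M = M 0 1 • stdSkew := by
  have h' (i j) : M j i = - M i j := congrFun (congrFun h i) j
  ext i j
  fin_cases i <;> fin_cases j <;> simp [stdSkew]
  · exact self_eq_neg.1 (h' 0 0)
  · exact h' 0 1
  · exact self_eq_neg.1 (h' 1 1)

/-- The columns of `U` are a unitary basis of the range of `Y`, which is an isotropic plane since
`Yᵀ Y = -Y² = 0`. -/
theorem isotropic_normal_form {Y : so n ℂ} (hY : Y ∈ isotropicSet n) :
    ∃ U : Matrix (Fin n) (Fin 2) ℂ, Uᴴ * U = 1 ∧ Uᵀ * U = 0 ∧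
      ∃ c : ℂ, (Y : Matrix (Fin n) (Fin n) ℂ) = c • (U * stdSkew * Uᵀ) := by
  obtain ⟨hr, hsq⟩ := hY
  obtain ⟨U, hU, hUY, W, hW⟩ := exists_isometry_range _ hr
  have hskew := mem_so.1 Y.2
  generalize (Y : Matrix (Fin n) (Fin n) ℂ) = Y at *
  refine ⟨U, hU, ?_, (Uᴴ * Y * Uᴴᵀ) 0 1, ?_⟩
  · rw [hW, transpose_mul, hskew, Matrix.mul_assoc, ← Matrix.mul_assoc (-Y), neg_mul, ← pow_two,
      hsq]
    simp
  · rw [← Matrix.smul_mul, ← Matrix.mul_smul, ← eq_smul_stdSkew]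
    · have h2 := congrArg transpose hUY
      rw [transpose_mul, hskew, transpose_mul, neg_mul, neg_inj] at h2
      calc Y = U * Uᴴ * (Y * (Uᴴᵀ * Uᵀ)) := by rw [h2, hUY]
        _ = _ := by simp only [Matrix.mul_assoc]
    · simp [transpose_mul, hskew, Matrix.mul_assoc]

/-- The determinant is `1` because the element is the square of an orthogonal matrix. -/
theorem torus_mem_SO {p : Matrix (Fin n) (Fin n) ℂ} (hp : p * p = p) (h1 : p * pᵀ = 0)
    (h2 : pᵀ * p = 0) {t : ℂ} (ht : t ≠ 0) :
    torus p pᵀ (t ^ 2) ∈ specialOrthogonalGroup (Fin n) ℂ := by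
  have hp' : pᵀ * pᵀ = pᵀ := by rw [← transpose_mul, hp]
  have hT (u : ℂ) : (torus p pᵀ u)ᵀ = torus pᵀ p u := by simp [torus]
  have horth (u : ℂ) (hu : u ≠ 0) : torus p pᵀ u * (torus p pᵀ u)ᵀ = 1 := by
    rw [hT, torus_mul_swap hp hp' h1 h2 hu]
  refine mem_specialOrthogonalGroup_iff.2
    ⟨(mem_orthogonalGroup_iff (Fin n) ℂ).2 (horth _ (pow_ne_zero 2 ht)), ?_⟩
  rw [pow_two, ← torus_mul hp hp' h1 h2, det_mul]
  have := congrArg det (horth t ht)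
  rwa [det_mul, det_transpose, det_one] at this

/-- A closed homogeneous condition satisfied on the invariant set `S` is satisfied on `S₀`. -/
theorem isotropic_mem {S : Set (so n ℂ)}
    (hinv : ∀ P : specialOrthogonalGroup (Fin n) ℂ, ∀ X ∈ S, adSO P X ∈ S)
    (hne : ∃ X ∈ S, X ≠ 0) (h4 : n = 4 → Submodule.span ℂ S = ⊤) {q : so n ℂ → ℂ}
    (hq : Continuous q) (hs : ∀ (c : ℂ) X, q (c • X) = (Complex.normSq c : ℂ) * q X)
    {K : Set ℂ} (hK : IsClosed K) (hKs : ∀ r : ℝ, 0 ≤ r → ∀ z ∈ K, (r : ℂ) * z ∈ K)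
    (hSK : ∀ X ∈ S, q X ∈ K) {Y : so n ℂ} (hY : Y ∈ isotropicSet n) : q Y ∈ K := by
  -- `Y² = 0` gives `2 * rank Y ≤ n`.
  have hn : 4 ≤ n := by
    have := rank_add_rank_le_card_of_mul_eq_zero ((pow_two _).symm.trans hY.2)
    rw [hY.1, Fintype.card_fin] at this
    exact this
  obtain ⟨U, hU, hUU, c, hc⟩ := isotropic_normal_form hY
  have hspan : Submodule.span ℂ S = ⊤ := by
    obtain rfl | h5 := hn.eq_or_lt
    · exact h4 rfl
    refine so_irreducible h5 _ (fun P X hX => ?_) ?_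
    · let ad : so n ℂ →ₗ[ℂ] so n ℂ :=
        { toFun := adSO P
          map_add' := fun X Y => Subtype.ext (by simp [adSO, mul_add, add_mul])
          map_smul' := fun c X => Subtype.ext (by simp [adSO]) }
      have : Submodule.span ℂ S ≤ (Submodule.span ℂ S).comap ad :=
        Submodule.span_le.2 fun X hX => Submodule.subset_span (hinv P X hX)
      exact this hX
    · obtain ⟨X, hX, h0⟩ := hne
      exact ⟨X, Submodule.subset_span hX, h0⟩
  have hUJU : U * stdSkew * Uᵀ ∈ so n ℂ := by
    rw [mem_so, transpose_mul, transpose_mul, transpose_transpose,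
      show stdSkewᵀ = -stdSkew by ext i j; fin_cases i <;> fin_cases j <;> simp [stdSkew]]
    simp [Matrix.mul_assoc]
  have hUt : Uᵀ * Uᴴᵀ = 1 := by rw [← transpose_mul, hU, transpose_one]
  have hUU' : Uᴴ * Uᴴᵀ = 0 := by
    rw [show Uᴴᵀ = Uᵀᴴ from rfl, ← conjTranspose_mul, hUU, conjTranspose_zero]
  -- The functional `X ↦ (Uᴴ X Ū)₀₁` takes the value `1` at `U J Uᵀ`, so it cannot vanish on `S`.
  obtain ⟨X, hX, hd⟩ : ∃ X ∈ S, (Uᴴ * (X : Matrix (Fin n) (Fin n) ℂ) * Uᴴᵀ) 0 1 ≠ 0 := by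
    by_contra! h
    let f : so n ℂ →ₗ[ℂ] ℂ :=
      { toFun := fun X => (Uᴴ * (X : Matrix (Fin n) (Fin n) ℂ) * Uᴴᵀ) 0 1
        map_add' := fun X Y => by simp [Matrix.mul_add, Matrix.add_mul]
        map_smul' := fun c X => by simp }
    have hker : Submodule.span ℂ S ≤ LinearMap.ker f := Submodule.span_le.2 h
    have h0 : f ⟨_, hUJU⟩ = 0 := hker (hspan ▸ Submodule.mem_top)
    have h1 : Uᴴ * (U * stdSkew * Uᵀ) * Uᴴᵀ = stdSkew := by
      calc _ = (Uᴴ * U) * stdSkew * (Uᵀ * Uᴴᵀ) := by simp only [Matrix.mul_assoc]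
        _ = _ := by rw [hU, hUt, Matrix.one_mul, Matrix.mul_one]
    change (Uᴴ * (U * stdSkew * Uᵀ) * Uᴴᵀ) 0 1 = 0 at h0
    rw [h1] at h0
    simp [stdSkew] at h0
  have hXt := mem_so.1 X.2
  have hYc : Y = c • (⟨_, hUJU⟩ : so n ℂ) := Subtype.ext hc
  rw [hYc]
  refine mem_of_smul_mem (V := so n ℂ) (q := q) hs hKs hd c ?_
  have hp : U * Uᴴ * (U * Uᴴ) = U * Uᴴ := by
    rw [Matrix.mul_assoc, ← Matrix.mul_assoc Uᴴ, hU, Matrix.one_mul]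
  have hpt : (U * Uᴴ)ᵀ = Uᴴᵀ * Uᵀ := transpose_mul _ _
  have h1 : U * Uᴴ * (U * Uᴴ)ᵀ = 0 := by
    rw [hpt, Matrix.mul_assoc, ← Matrix.mul_assoc Uᴴ, hUU', Matrix.zero_mul, Matrix.mul_zero]
  have h2 : (U * Uᴴ)ᵀ * (U * Uᴴ) = 0 := by
    rw [hpt, Matrix.mul_assoc, ← Matrix.mul_assoc Uᵀ, hUU, Matrix.zero_mul, Matrix.mul_zero]
  have hT (s : ℝ) (h : s > 0) : torus (U * Uᴴ) (U * Uᴴ)ᵀ ((s ^ 2 : ℝ) : ℂ) ∈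
      specialOrthogonalGroup (Fin n) ℂ := by
    rw [Complex.ofReal_pow]
    exact torus_mem_SO hp h1 h2 (Complex.ofReal_ne_zero.2 h.ne')
  have hTt (u : ℂ) : torus (U * Uᴴ)ᵀ (U * Uᴴ) u = (torus (U * Uᴴ) (U * Uᴴ)ᵀ u)ᵀ := by simp [torus]
  have hZ (s : ℝ) : torus (U * Uᴴ) (U * Uᴴ)ᵀ ((s ^ 2 : ℝ) : ℂ) * (X : Matrix (Fin n) (Fin n) ℂ) *
      torus (U * Uᴴ)ᵀ (U * Uᴴ) ((s ^ 2 : ℝ) : ℂ) ∈ so n ℂ := by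
    rw [hTt, mem_so]
    simp only [transpose_mul, transpose_transpose, hXt]
    simp [Matrix.mul_assoc]
  refine mem_of_tendsto_smul (V := so n ℂ) hq hs hK hKs
    (c := fun s : ℝ => (((s ^ 2 : ℝ) : ℂ)⁻¹ * ((s ^ 2 : ℝ) : ℂ)⁻¹)) (Z := fun s => ⟨_, hZ s⟩)
    (tendsto_subtype_rng.2 ?_) fun s h => ?_
  · convert! tendsto_torus_conj (U * Uᴴ) (U * Uᴴ)ᵀ (X : Matrix (Fin n) (Fin n) ℂ) using 2
    rw [Submodule.coe_smul]
    change _ • (U * stdSkew * Uᵀ) = _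
    rw [← Matrix.smul_mul, ← Matrix.mul_smul, ← eq_smul_stdSkew]
    · simp only [hpt, Matrix.mul_assoc]
    · simp [transpose_mul, hXt, Matrix.mul_assoc]
  · convert hSK _ (hinv ⟨_, hT s h⟩ X hX) using 2
    apply Subtype.ext
    simp only [adSO, hTt]
    rw [← inv_eq_transpose ⟨_, hT s h⟩]

/-! ### Nonnegative orthogonal bisectional curvature -/

theorem continuous_hermU_extendU (R : u n →ₗ[ℝ] u n) :
    Continuous fun X => hermU (extendU R X) X := by
  have h1 : Continuous (extendU R) := LinearMap.continuous_of_finiteDimensional _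
  exact (h1.matrix_mul continuous_id.matrix_conjTranspose).matrix_trace

theorem hermU_extendU_smul (R : u n →ₗ[ℝ] u n) (c : ℂ) (X : Matrix (Fin n) (Fin n) ℂ) :
    hermU (extendU R (c • X)) (c • X) = (Complex.normSq c : ℂ) * hermU (extendU R X) X := by
  rw [hermU, map_smul, conjTranspose_smul, smul_mul_smul_comm, trace_smul, ← starRingEnd_apply,
    Complex.mul_conj, smul_eq_mul, hermU]

theorem smul_mul_eq_mul_mul {m k : Type*} (x : Matrix m (Fin 1) ℂ) (M : Matrix (Fin 1) (Fin 1) ℂ)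
    (y : Matrix (Fin 1) k ℂ) : M 0 0 • (x * y) = x * M * y := by
  have h : M = M 0 0 • (1 : Matrix (Fin 1) (Fin 1) ℂ) := by
    ext i j; fin_cases i; fin_cases j; simp
  conv_rhs => rw [h]
  simp

/-- `x` spans the range of `Y` and `y` that of `Yᴴ`; they are orthogonal since `Y² = 0`. -/
theorem orthBisectional_normal_form {Y : Matrix (Fin n) (Fin n) ℂ} (hY : Y ∈ orthBisectionalSet n) :
    ∃ x y : Matrix (Fin n) (Fin 1) ℂ, xᴴ * x = 1 ∧ yᴴ * y = 1 ∧ yᴴ * x = 0 ∧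
      ∃ c : ℂ, Y = c • (x * yᴴ) := by
  obtain ⟨hr, hsq⟩ := hY
  obtain ⟨x, hx, hxY, W, hW⟩ := exists_isometry_range Y hr
  obtain ⟨y, hy, hyY, W', hW'⟩ := exists_isometry_range Yᴴ ((rank_conjTranspose Y).trans hr)
  have hYy : Y * (y * yᴴ) = Y := by
    simpa [conjTranspose_mul] using congrArg conjTranspose hyY
  refine ⟨x, y, hx, hy, ?_, (xᴴ * Y * y) 0 0, ?_⟩
  · rw [hW, hW', conjTranspose_mul, conjTranspose_conjTranspose, Matrix.mul_assoc,
      ← Matrix.mul_assoc Y, ← pow_two, hsq]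
    simp
  · calc Y = x * xᴴ * (Y * (y * yᴴ)) := by rw [hYy, hxY]
      _ = x * (xᴴ * Y * y) * yᴴ := by simp only [Matrix.mul_assoc]
      _ = _ := (smul_mul_eq_mul_mul _ _ _).symm

/-- If `v` and `X v` are independent, choose `Q` invertible with `Q y = v` and `Q x = X v`; then
`xᴴ Q⁻¹ X Q y = xᴴ x = 1`. -/
theorem exists_GL_pairing_ne_zero {X : Matrix (Fin n) (Fin n) ℂ} (hX : ∀ c : ℂ, X ≠ c • 1)
    {x y : Matrix (Fin n) (Fin 1) ℂ} (hx : xᴴ * x = 1) (hy : yᴴ * y = 1) (hyx : yᴴ * x = 0) :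
    ∃ P : GeneralLinearGroup (Fin n) ℂ, (xᴴ * adGL P X * y) 0 0 ≠ 0 := by
  obtain ⟨v, hv⟩ : ∃ v, LinearIndependent ℂ ![v, toLin' X v] := by
    by_contra! h
    obtain ⟨a, ha⟩ := LinearMap.exists_eq_smul_id_of_forall_notLinearIndependent h
    refine hX a (toLin'.injective ?_)
    rw [ha, map_smul, toLin'_one]
    rfl
  have hyx' : LinearIndependent ℂ ![y.col 0, x.col 0] := by
    rw [LinearIndependent.pair_iff]
    intro s t h
    have h' : s • y + t • x = 0 := by
      ext i j; fin_cases j; simpa using congrFun h i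
    have hxy : xᴴ * y = 0 := by simpa [conjTranspose_mul] using congrArg conjTranspose hyx
    have e1 := congrArg (fun z => (yᴴ * z) 0 0) h'
    have e2 := congrArg (fun z => (xᴴ * z) 0 0) h'
    simp [Matrix.mul_add, hx, hy, hyx, hxy] at e1 e2
    exact ⟨e1, e2⟩
  obtain ⟨g, hg⟩ := Submodule.exists_linearEquiv_restrict_eq
    ((Module.Basis.span hyx').equiv (Module.Basis.span hv) (Equiv.refl _))
  have hgi (i : Fin 2) : g (![y.col 0, x.col 0] i) = ![v, toLin' X v] i := by
    have := hg (Module.Basis.span hyx' i)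
    rw [Module.Basis.equiv_apply, Module.Basis.span_apply, Module.Basis.span_apply] at this
    exact this.symm
  let Q := LinearMap.toMatrix' (g : (Fin n → ℂ) →ₗ[ℂ] (Fin n → ℂ))
  let Q' := LinearMap.toMatrix' (g.symm : (Fin n → ℂ) →ₗ[ℂ] (Fin n → ℂ))
  have hQQ' : Q * Q' = 1 := by
    rw [← LinearMap.toMatrix'_comp]; simp
  have hQ'Q : Q' * Q = 1 := by
    rw [← LinearMap.toMatrix'_comp]; simp
  have hQy : Q *ᵥ y.col 0 = v := (LinearMap.toMatrix'_mulVec _ _).trans (hgi 0)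
  have hQx : Q *ᵥ x.col 0 = X *ᵥ v := (LinearMap.toMatrix'_mulVec _ _).trans (hgi 1)
  have hmat : X * (Q * y) = Q * x := by
    ext i j
    fin_cases j
    change (X *ᵥ (Q *ᵥ y.col 0)) i = (Q *ᵥ x.col 0) i
    rw [hQy, hQx]
  refine ⟨⟨Q', Q, hQ'Q, hQQ'⟩, ?_⟩
  have : xᴴ * adGL ⟨Q', Q, hQ'Q, hQQ'⟩ X * y = 1 := by
    rw [adGL]
    change xᴴ * (Q' * X * Q'⁻¹) * y = 1
    rw [inv_eq_right_inv hQ'Q]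
    calc _ = xᴴ * Q' * (X * (Q * y)) := by simp only [Matrix.mul_assoc]
      _ = xᴴ * ((Q' * Q) * x) := by rw [hmat]; simp only [Matrix.mul_assoc]
      _ = 1 := by rw [hQ'Q, Matrix.one_mul, hx]
  rw [this]
  simp

/-- A closed homogeneous condition satisfied on the invariant set `S` is satisfied on `S₁`. -/
theorem orthBisectional_mem {S : Set (Matrix (Fin n) (Fin n) ℂ)}
    (hinv : ∀ P : GeneralLinearGroup (Fin n) ℂ, ∀ X ∈ S, adGL P X ∈ S)
    (hne : ∃ X ∈ S, ∀ c : ℂ, X ≠ c • (1 : Matrix (Fin n) (Fin n) ℂ))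
    {q : Matrix (Fin n) (Fin n) ℂ → ℂ}
    (hq : Continuous q) (hs : ∀ (c : ℂ) X, q (c • X) = (Complex.normSq c : ℂ) * q X)
    {K : Set ℂ} (hK : IsClosed K) (hKs : ∀ r : ℝ, 0 ≤ r → ∀ z ∈ K, (r : ℂ) * z ∈ K)
    (hSK : ∀ X ∈ S, q X ∈ K) {Y : Matrix (Fin n) (Fin n) ℂ} (hY : Y ∈ orthBisectionalSet n) :
    q Y ∈ K := by
  obtain ⟨x, y, hx, hy, hyx, c, rfl⟩ := orthBisectional_normal_form hY
  obtain ⟨X, hX, hd⟩ : ∃ X ∈ S, (xᴴ * X * y) 0 0 ≠ 0 := by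
    obtain ⟨X, hX, hXc⟩ := hne
    obtain ⟨P, hP⟩ := exists_GL_pairing_ne_zero hXc hx hy hyx
    exact ⟨_, hinv P X hX, hP⟩
  refine mem_of_smul_mem hs hKs hd c ?_
  have hxy : xᴴ * y = 0 := by simpa [conjTranspose_mul] using congrArg conjTranspose hyx
  have hp : x * xᴴ * (x * xᴴ) = x * xᴴ := by
    rw [Matrix.mul_assoc, ← Matrix.mul_assoc xᴴ, hx, Matrix.one_mul]
  have hr : y * yᴴ * (y * yᴴ) = y * yᴴ := by
    rw [Matrix.mul_assoc, ← Matrix.mul_assoc yᴴ, hy, Matrix.one_mul]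
  have hpr : x * xᴴ * (y * yᴴ) = 0 := by
    rw [Matrix.mul_assoc, ← Matrix.mul_assoc xᴴ, hxy, Matrix.zero_mul, Matrix.mul_zero]
  have hrp : y * yᴴ * (x * xᴴ) = 0 := by
    rw [Matrix.mul_assoc, ← Matrix.mul_assoc yᴴ, hyx, Matrix.zero_mul, Matrix.mul_zero]
  have hL : (xᴴ * X * y) 0 0 • (x * yᴴ) = x * xᴴ * X * (y * yᴴ) := by
    rw [smul_mul_eq_mul_mul]
    simp only [Matrix.mul_assoc]
  rw [hL]
  refine mem_of_tendsto_smul hq hs hK hKs (tendsto_torus_conj (x * xᴴ) (y * yᴴ) X) fun s h => ?_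
  have hs0 : ((s ^ 2 : ℝ) : ℂ) ≠ 0 := Complex.ofReal_ne_zero.2 (pow_ne_zero 2 h.ne')
  have e1 := torus_mul_swap hp hr hpr hrp hs0
  have e2 := torus_mul_swap hr hp hrp hpr hs0
  have := hSK _ (hinv ⟨_, _, e1, e2⟩ X hX)
  rw [adGL] at this
  change q (torus (x * xᴴ) (y * yᴴ) ((s ^ 2 : ℝ) : ℂ) * X *
      (torus (x * xᴴ) (y * yᴴ) ((s ^ 2 : ℝ) : ℂ))⁻¹) ∈ K at this
  rwa [inv_eq_right_inv e1] at this

theorem isClosed_nonneg_complex : IsClosed {z : ℂ | 0 ≤ z} := by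
  simp only [Complex.le_def, Complex.zero_re, Complex.zero_im]
  exact (isClosed_le continuous_const Complex.continuous_re).inter
    (isClosed_eq continuous_const Complex.continuous_im)

theorem ofReal_mul_nonneg (r : ℝ) (hr : 0 ≤ r) (z : ℂ) (hz : z ∈ {z : ℂ | 0 ≤ z}) :
    (r : ℂ) * z ∈ {z : ℂ | 0 ≤ z} :=
  mul_nonneg (Complex.zero_le_real.2 hr) hz

end WilkingCone

theorem theorem1 :
    (∀ (n : ℕ) (S : Set (WilkingCone.so n ℂ)),
      (∀ P : Matrix.specialOrthogonalGroup (Fin n) ℂ, ∀ X ∈ S, WilkingCone.adSO P X ∈ S) →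
      (∃ X ∈ S, X ≠ 0) →
      (n = 4 → Submodule.span ℂ S = ⊤) →
      WilkingCone.coneSo S ⊆ WilkingCone.coneSo (WilkingCone.isotropicSet n) ∧
      ∀ R ∈ WilkingCone.symSo n,
        (∀ X ∈ S, WilkingCone.hermSo (WilkingCone.extendSo R X) X = 0) →
        ∀ Y ∈ WilkingCone.isotropicSet n,
          WilkingCone.hermSo (WilkingCone.extendSo R Y) Y = 0) ∧
    (∀ (n : ℕ) (S : Set (Matrix (Fin n) (Fin n) ℂ)),
      (∀ P : Matrix.GeneralLinearGroup (Fin n) ℂ, ∀ X ∈ S, WilkingCone.adGL P X ∈ S) →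
      (∃ X ∈ S, ∀ c : ℂ, X ≠ c • (1 : Matrix (Fin n) (Fin n) ℂ)) →
      WilkingCone.coneU S ⊆ WilkingCone.coneU (WilkingCone.orthBisectionalSet n) ∧
      ∀ R ∈ WilkingCone.symU n,
        (∀ X ∈ S, WilkingCone.hermU (WilkingCone.extendU R X) X = 0) →
        ∀ Y ∈ WilkingCone.orthBisectionalSet n,
          WilkingCone.hermU (WilkingCone.extendU R Y) Y = 0) := by
  have h0 : ∀ r : ℝ, 0 ≤ r → ∀ z ∈ ({0} : Set ℂ), (r : ℂ) * z ∈ ({0} : Set ℂ) := by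
    rintro r - _ rfl
    simp
  refine ⟨fun n S hinv hne h4 => ⟨fun R hR => ⟨hR.1, fun Y hY => ?_⟩, fun R _ hR Y hY => ?_⟩,
    fun n S hinv hne => ⟨fun R hR => ⟨hR.1, fun Y hY => ?_⟩, fun R _ hR Y hY => ?_⟩⟩
  · exact WilkingCone.isotropic_mem hinv hne h4 (WilkingCone.continuous_hermSo_extendSo R)
      (WilkingCone.hermSo_extendSo_smul R) WilkingCone.isClosed_nonneg_complex
      WilkingCone.ofReal_mul_nonneg hR.2 hY
  · exact WilkingCone.isotropic_mem hinv hne h4 (WilkingCone.continuous_hermSo_extendSo R)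
      (WilkingCone.hermSo_extendSo_smul R) isClosed_singleton h0 hR hY
  · exact WilkingCone.orthBisectional_mem hinv hne (WilkingCone.continuous_hermU_extendU R)
      (WilkingCone.hermU_extendU_smul R) WilkingCone.isClosed_nonneg_complex
      WilkingCone.ofReal_mul_nonneg hR.2 hY
  · exact WilkingCone.orthBisectional_mem hinv hne (WilkingCone.continuous_hermU_extendU R)
      (WilkingCone.hermU_extendU_smul R) isClosed_singleton h0 hR hY
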